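/- Let $n$ be a positive integer, $1<p<\infty$ and $1/p+1/p'=1$. For $\sigma\ge 0$ and a Schwartz function $g:\mathbb R^n\to\mathbb C$ let $(-\Delta)^{\sigma}g$ be the function whose Fourier transform is $(4\pi^2|\xi|^2)^{\sigma}\,\hat g(\xi)$, where $\hat g(\xi)=\int_{\mathbb R^n} e^{-2\pi i x\cdot\xi}g(x)\,dx$. (a) Let $\alpha,\beta\in\mathbb R$ satisfy $0<\alpha+\beta<n$, $\alpha<n/p$ and $\beta<n/p'$. Then for every $g\in\mathcal S(\mathbb R^n)$ $$\big\||x|^{-\alpha}g\big\|_{L^p(\mathbb R^n)}\le 2^{-(\alpha+\beta)}\left[\frac{\Gamma\big(\frac{n}{2p}-\frac{\alpha}{2}\big)\,\Gamma\big(\frac{n}{2p'}-\frac{\beta}{2}\big)}{\Gamma\big(\frac{n}{2p'}+\frac{\alpha}{2}\big)\,\Gamma\big(\frac{n}{2p}+\frac{\beta}{2}\big)}\right]\big\||x|^{\beta}(-\Delta)^{(\alpha+\beta)/2}g\big\|_{L^p(\mathbb R^n)}.$$ (b) (Davies–Hinz inequality.) Let $m\ge 1$ be an integer and $\gamma\in\mathbb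 R$ with $\gamma+2mp<n$ and $-\gamma/p<n/p'$. Then for every $u\in\mathcal S(\mathbb R^n)$ $$\int_{\mathbb R^n}|x|^{-\gamma}|\Delta^m u|^p\,dx\ \ge\ A_{\gamma,m}\int_{\mathbb R^n}|x|^{-\gamma-2mp}|u|^p\,dx,$$ where $$A_{\gamma,m}=2^{2mp}\left[\frac{\Gamma\big(\frac{n}{2p'}+\frac{\gamma}{2p}+m\big)\,\Gamma\big(\frac{n-\gamma}{2p}\big)}{\Gamma\big(\frac{n-\gamma}{2p}-m\big)\,\Gamma\big(\frac{n}{2p'}+\frac{\gamma}{2p}\big)}\right]^{p}>0.$$ -/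

import Mathlib

open MeasureTheory
open scoped SchwartzMap FourierTransform

/-- The fractional power `(-Δ)^σ` of the Laplacian of a function `g` on `ℝⁿ`, defined
through the Fourier transform: with `𝓕 g ξ = ∫ exp (-2πi⟨x, ξ⟩) g x dx`, it is the inverse
Fourier transform of `ξ ↦ (4π²|ξ|²)^σ 𝓕 g ξ`. For a Schwartz function `g` and `σ ≥ 0` the
function `ξ ↦ (4π²|ξ|²)^σ 𝓕 g ξ` is integrable, so the inverse transform is an absolutely
convergent integral at every point. -/
noncomputable def fracNegLaplacian {n : ℕ} (σ : ℝ) (g : EuclideanSpace ℝ (Fin n) → ℂ) :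
    EuclideanSpace ℝ (Fin n) → ℂ :=
  𝓕⁻ (fun ξ : EuclideanSpace ℝ (Fin n) =>
    (((2 * Real.pi * ‖ξ‖) ^ (2 * σ) : ℝ) : ℂ) * 𝓕 g ξ)

/-- The constant of the weighted Sobolev inequality in dimension `n`, with `q` the exponent
conjugate to `p`. -/
noncomputable def hardyRellichConst (n : ℕ) (p q α β : ℝ) : ℝ :=
  2 ^ (-(α + β)) *
    ((Real.Gamma (n / (2 * p) - α / 2) * Real.Gamma (n / (2 * q) - β / 2)) /
      (Real.Gamma (n / (2 * q) + α / 2) * Real.Gamma (n / (2 * p) + β / 2)))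

/-- The constant of the Davies–Hinz inequality in dimension `n`, with `q` the exponent
conjugate to `p`. -/
noncomputable def daviesHinzConst (n : ℕ) (p q γ : ℝ) (m : ℕ) : ℝ :=
  2 ^ (2 * m * p) *
    ((Real.Gamma (n / (2 * q) + γ / (2 * p) + m) * Real.Gamma ((n - γ) / (2 * p))) /
      (Real.Gamma ((n - γ) / (2 * p) - m) * Real.Gamma (n / (2 * q) + γ / (2 * p)))) ^ p

/-!
Write `s = α + β` and `d` for the dimension. The function `g` is the Riesz potential of order `s`
of `f = (-Δ)^(s/2) g`, so that `|x|^(-α) |g(x)|` is at most the integral of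
`K(x, y) = |x|^(-α) k(x - y) |y|^(-β)` against `|y|^β |f(y)|`, where `k` is the Riesz kernel.
It remains to bound the operator with kernel `K` on `L^p` (the Stein–Weiss inequality). The kernel
is positive and homogeneous of degree `-d`, so `|y|^(-d/p)` is an eigenfunction of the operator and
`|x|^(-d/q)` is one of its transpose; both eigenvalues are the constant of the inequality. Schur's
test, `lintegral_rpow_lintegral_mul_le_of_schur`, with the weight `|x|^(-d/(pq))` then gives exactly
this constant as a bound of the norm.

Everything about the Riesz kernels comes from the subordination formula
`Γ(s/2) (-Δ)^(-s/2) = ∫₀^∞ t^(s/2-1) exp (tΔ) dt`.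

* The eigenvalue is the Riesz potential of a power of the norm. A power of the norm is itself a
  Riesz kernel (`rieszKernel_eq`), and the Riesz kernels form a semigroup under convolution
  (`lintegral_rieszKernel_sub_mul_rieszKernel`): the convolution of two of them reduces, by the
  semigroup law of the heat kernel, to a Beta integral.
* The pointwise bound of `g` by the Riesz potential of `|f|` is
  `ofReal_Gamma_mul_enorm_fourierInv_le`: `∫₀^∞ t^(s/2-1) exp (tΔ) f dt` is computed on the Fourier
  side, where all integrals converge absolutely, and estimated in space, where all integrands are
  nonnegative and have values in `ℝ≥0∞`. No decay of `f` at infinity is required.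

The Davies–Hinz inequality is the case `β = -γ/p`, `α + β = 2m` of the weighted Sobolev inequality,
since `(-Δ)^m` is the classical iterated Laplacian up to sign on Schwartz functions.
-/

/-! ### Gamma and Beta integrals as lower Lebesgue integrals -/

/-- Euler's integral for the Gamma function, with values in `ℝ≥0∞`. -/
theorem lintegral_rpow_mul_exp_neg_mul_Ioi {a r : ℝ} (ha : 0 < a) (hr : 0 < r) :
    ∫⁻ t in Set.Ioi (0 : ℝ), ENNReal.ofReal (t ^ (a - 1) * Real.exp (-(r * t))) =
      ENNReal.ofReal ((1 / r) ^ a * Real.Gamma a) := by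
  rw [← Real.integral_rpow_mul_exp_neg_mul_Ioi ha hr, ofReal_integral_eq_lintegral_ofReal]
  · have := integrableOn_rpow_mul_exp_neg_mul_rpow (p := 1) (s := a - 1) (b := r)
      (by linarith) one_pos hr
    simpa [IntegrableOn] using this
  · filter_upwards [ae_restrict_mem measurableSet_Ioi] with t ht
    have : 0 < t := ht
    positivity

theorem lintegral_rpow_mul_exp_neg_div_Ioi {a r : ℝ} (ha : 0 < a) (hr : 0 < r) :
    ∫⁻ t in Set.Ioi (0 : ℝ), ENNReal.ofReal (t ^ (-a - 1) * Real.exp (-(r / t))) =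
      ENNReal.ofReal ((1 / r) ^ a * Real.Gamma a) := by
  have himg : (fun x : ℝ => x⁻¹) '' Set.Ioi (0 : ℝ) = Set.Ioi 0 := by
    ext x
    simp
  have hderiv : ∀ x ∈ Set.Ioi (0 : ℝ),
      HasDerivWithinAt (fun x : ℝ => x⁻¹) (-(x ^ 2)⁻¹) (Set.Ioi 0) x := fun x hx =>
    (hasDerivAt_inv (ne_of_gt hx)).hasDerivWithinAt
  have h := lintegral_image_eq_lintegral_abs_deriv_mul measurableSet_Ioi hderiv
    inv_injective.injOn (fun t => ENNReal.ofReal (t ^ (a - 1) * Real.exp (-(r * t))))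
  rw [himg, lintegral_rpow_mul_exp_neg_mul_Ioi ha hr] at h
  rw [h]
  refine setLIntegral_congr_fun measurableSet_Ioi fun t ht => ?_
  have ht : 0 < t := ht
  rw [← ENNReal.ofReal_mul (abs_nonneg _), abs_neg, abs_of_pos (by positivity), ← mul_assoc,
    ← div_eq_mul_inv r t]
  congr 2
  rw [Real.inv_rpow ht.le, ← Real.rpow_neg ht.le, ← Real.rpow_natCast, ← Real.rpow_neg ht.le,
    ← Real.rpow_add ht]
  congr 1
  push_cast
  ring

theorem lintegral_Ioo_rpow_mul_rpow_scaling (a b : ℝ) {r : ℝ} (hr : 0 < r) :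
    ∫⁻ t in Set.Ioo 0 r, ENNReal.ofReal (t ^ (a - 1) * (r - t) ^ (b - 1)) =
      ENNReal.ofReal (r ^ (a + b - 1)) *
        ∫⁻ t in Set.Ioo (0 : ℝ) 1, ENNReal.ofReal (t ^ (a - 1) * (1 - t) ^ (b - 1)) := by
  have himg : (fun x : ℝ => r * x) '' Set.Ioo (0 : ℝ) 1 = Set.Ioo 0 r := by
    rw [Set.image_mul_left_Ioo hr]
    simp
  have hderiv : ∀ x ∈ Set.Ioo (0 : ℝ) 1,
      HasDerivWithinAt (fun x : ℝ => r * x) r (Set.Ioo 0 1) x := fun x _ => by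
    simpa using ((hasDerivAt_id x).const_mul r).hasDerivWithinAt
  have h := lintegral_image_eq_lintegral_abs_deriv_mul measurableSet_Ioo hderiv
    (mul_right_injective₀ hr.ne').injOn
    (fun t => ENNReal.ofReal (t ^ (a - 1) * (r - t) ^ (b - 1)))
  rw [himg] at h
  rw [h, ← lintegral_const_mul' _ _ ENNReal.ofReal_ne_top]
  refine setLIntegral_congr_fun measurableSet_Ioo fun t ht => ?_
  obtain ⟨ht0, ht1⟩ := ht
  have h1 : 0 < 1 - t := by linarith
  rw [← ENNReal.ofReal_mul (abs_nonneg _), ← ENNReal.ofReal_mul (by positivity), abs_of_pos hr,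
    Real.mul_rpow hr.le ht0.le, show r - r * t = r * (1 - t) by ring, Real.mul_rpow hr.le h1.le,
    show a + b - 1 = 1 + (a - 1) + (b - 1) by ring, Real.rpow_add hr, Real.rpow_add hr,
    Real.rpow_one]
  congr 1
  ring

/-- Integrating a function of `t + τ` against `t ^ (a - 1) τ ^ (b - 1)`, before the Beta integral
has been evaluated. -/
theorem lintegral_rpow_mul_rpow_mul_comp_add_aux (a b : ℝ) {F : ℝ → ENNReal} (hF : Measurable F) :
    ∫⁻ t in Set.Ioi (0 : ℝ), ∫⁻ τ in Set.Ioi (0 : ℝ),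
        ENNReal.ofReal (t ^ (a - 1) * τ ^ (b - 1)) * F (t + τ) =
      (∫⁻ t in Set.Ioo (0 : ℝ) 1, ENNReal.ofReal (t ^ (a - 1) * (1 - t) ^ (b - 1))) *
        ∫⁻ r in Set.Ioi (0 : ℝ), ENNReal.ofReal (r ^ (a + b - 1)) * F r := by
  -- Both sides are integrals over the region `0 < t < r` of the plane, where `r = t + τ`.
  set T : Set (ℝ × ℝ) := {z | 0 < z.1 ∧ z.1 < z.2} with hT
  have hTm : MeasurableSet T :=
    (measurableSet_lt measurable_const measurable_fst).inter
      (measurableSet_lt measurable_fst measurable_snd)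
  set G : ℝ × ℝ → ENNReal := T.indicator
    (fun z => ENNReal.ofReal (z.1 ^ (a - 1) * (z.2 - z.1) ^ (b - 1)) * F z.2) with hG
  have hGm : Measurable G := by
    refine Measurable.indicator ?_ hTm
    fun_prop
  have hleft : ∫⁻ t in Set.Ioi (0 : ℝ), ∫⁻ τ in Set.Ioi (0 : ℝ),
      ENNReal.ofReal (t ^ (a - 1) * τ ^ (b - 1)) * F (t + τ) = ∫⁻ t, ∫⁻ r, G (t, r) := by
    rw [← lintegral_indicator measurableSet_Ioi]
    refine lintegral_congr fun t => ?_
    rw [← lintegral_add_left_eq_self (fun r => G (t, r)) t]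
    by_cases ht : 0 < t
    · rw [Set.indicator_of_mem (Set.mem_Ioi.2 ht), ← lintegral_indicator measurableSet_Ioi]
      refine lintegral_congr fun τ => ?_
      by_cases hτ : 0 < τ <;> simp [hG, hT, Set.indicator, ht, hτ]
    · simp [hG, hT, Set.indicator, ht]
  have hright : ∀ r, ∫⁻ t, G (t, r) = (Set.Ioi (0 : ℝ)).indicator (fun r =>
      (∫⁻ t in Set.Ioo (0 : ℝ) 1, ENNReal.ofReal (t ^ (a - 1) * (1 - t) ^ (b - 1))) *
        (ENNReal.ofReal (r ^ (a + b - 1)) * F r)) r := by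
    intro r
    by_cases hr : 0 < r
    · rw [Set.indicator_of_mem (Set.mem_Ioi.2 hr), ← mul_assoc,
        mul_comm (∫⁻ t in Set.Ioo (0 : ℝ) 1, _),
        ← lintegral_Ioo_rpow_mul_rpow_scaling a b hr, ← lintegral_mul_const _ (by fun_prop),
        ← lintegral_indicator measurableSet_Ioo]
      refine lintegral_congr fun t => ?_
      by_cases ht : 0 < t <;> by_cases ht' : t < r <;>
        simp [hG, hT, Set.indicator, ht, ht']
    · have hzero : ∀ t, G (t, r) = 0 := fun t => by
        have : ¬ (0 < t ∧ t < r) := fun h => hr (h.1.trans h.2)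
        simp only [hG, hT, Set.indicator, Set.mem_ofPred_eq, if_neg this]
      simp [hzero, hr]
  rw [hleft, lintegral_lintegral_swap (f := fun t r => G (t, r)) hGm.aemeasurable]
  simp_rw [hright]
  rw [lintegral_indicator measurableSet_Ioi, lintegral_const_mul _ (by fun_prop)]

/-- The Beta integral. The value is read off from
`lintegral_rpow_mul_rpow_mul_comp_add_aux` at `F = exp (-·)`. -/
theorem lintegral_Ioo_rpow_mul_rpow {a b : ℝ} (ha : 0 < a) (hb : 0 < b) :
    ∫⁻ t in Set.Ioo (0 : ℝ) 1, ENNReal.ofReal (t ^ (a - 1) * (1 - t) ^ (b - 1)) =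
      ENNReal.ofReal (Real.Gamma a * Real.Gamma b / Real.Gamma (a + b)) := by
  have h := lintegral_rpow_mul_rpow_mul_comp_add_aux a b
    (F := fun r => ENNReal.ofReal (Real.exp (-r))) (by fun_prop)
  have hG : ∀ {c : ℝ}, 0 < c →
      ∫⁻ r in Set.Ioi (0 : ℝ), ENNReal.ofReal (r ^ (c - 1)) * ENNReal.ofReal (Real.exp (-r)) =
        ENNReal.ofReal (Real.Gamma c) := fun {c} hc => by
    have := lintegral_rpow_mul_exp_neg_mul_Ioi hc one_pos
    simp only [one_mul, div_one, Real.one_rpow] at this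
    rw [← this]
    refine setLIntegral_congr_fun measurableSet_Ioi fun t ht => ?_
    exact (ENNReal.ofReal_mul (Real.rpow_nonneg (le_of_lt ht) _)).symm
  have hl : ∫⁻ t in Set.Ioi (0 : ℝ), ∫⁻ τ in Set.Ioi (0 : ℝ),
      ENNReal.ofReal (t ^ (a - 1) * τ ^ (b - 1)) * ENNReal.ofReal (Real.exp (-(t + τ))) =
      ENNReal.ofReal (Real.Gamma a) * ENNReal.ofReal (Real.Gamma b) := by
    rw [← hG ha, ← hG hb, ← lintegral_mul_const _ (by fun_prop)]
    refine setLIntegral_congr_fun measurableSet_Ioi fun t ht => ?_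
    rw [← lintegral_const_mul _ (by fun_prop)]
    refine lintegral_congr fun τ => ?_
    have ht : 0 < t := ht
    rw [ENNReal.ofReal_mul (by positivity), neg_add, Real.exp_add,
      ENNReal.ofReal_mul (by positivity)]
    ring
  have hab := Real.Gamma_pos_of_pos (add_pos ha hb)
  rw [hl, hG (add_pos ha hb)] at h
  rw [ENNReal.ofReal_div_of_pos hab, ENNReal.ofReal_mul (Real.Gamma_pos_of_pos ha).le, h,
    ENNReal.mul_div_cancel_right (by simpa using hab) ENNReal.ofReal_ne_top]

theorem lintegral_rpow_mul_rpow_mul_comp_add {a b : ℝ} (ha : 0 < a) (hb : 0 < b)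
    {F : ℝ → ENNReal} (hF : Measurable F) :
    ∫⁻ t in Set.Ioi (0 : ℝ), ∫⁻ τ in Set.Ioi (0 : ℝ),
        ENNReal.ofReal (t ^ (a - 1) * τ ^ (b - 1)) * F (t + τ) =
      ENNReal.ofReal (Real.Gamma a * Real.Gamma b / Real.Gamma (a + b)) *
        ∫⁻ r in Set.Ioi (0 : ℝ), ENNReal.ofReal (r ^ (a + b - 1)) * F r := by
  rw [lintegral_rpow_mul_rpow_mul_comp_add_aux a b hF, lintegral_Ioo_rpow_mul_rpow ha hb]

/-! ### The heat semigroup and the Riesz kernels -/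

section Kernels

variable {V : Type*} [NormedAddCommGroup V] [InnerProductSpace ℝ V]

/-- The Gauss–Weierstrass kernel `h_t(x) = (4πt)^(-d/2) exp (-|x|²/(4t))` of the heat semigroup
`exp (tΔ)`, where `d` is the dimension of `V`. -/
noncomputable def heatKernel (t : ℝ) (x : V) : ℝ :=
  (4 * Real.pi * t) ^ (-(Module.finrank ℝ V : ℝ) / 2) * Real.exp (-(‖x‖ ^ 2 / (4 * t)))

/-- The Riesz kernel of order `s`, multiplied by `Γ(s/2)`: the kernel of
`Γ(s/2) (-Δ)^(-s/2) = ∫₀^∞ t^(s/2-1) exp (tΔ) dt`, as a function with values in `ℝ≥0∞`. -/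
noncomputable def rieszKernel (s : ℝ) (x : V) : ENNReal :=
  ∫⁻ t in Set.Ioi (0 : ℝ), ENNReal.ofReal (t ^ (s / 2 - 1) * heatKernel t x)

theorem heatKernel_nonneg {t : ℝ} (ht : 0 < t) (x : V) : 0 ≤ heatKernel t x := by
  unfold heatKernel
  positivity

theorem heatKernel_neg (t : ℝ) (x : V) : heatKernel t (-x) = heatKernel t x := by
  simp [heatKernel]

theorem rieszKernel_neg (s : ℝ) (x : V) : rieszKernel s (-x) = rieszKernel s x := by
  simp [rieszKernel, heatKernel_neg]

theorem rieszKernel_sub_comm (s : ℝ) (x y : V) : rieszKernel s (x - y) = rieszKernel s (y - x) := by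
  rw [← rieszKernel_neg, neg_sub]

/-- The constant in `rieszKernel s x = rieszConst d s * |x| ^ (s - d)`, valid for `s < d` and
`x ≠ 0`. -/
noncomputable def rieszConst (d s : ℝ) : ℝ :=
  Real.pi ^ (-d / 2) * 2 ^ (-s) * Real.Gamma ((d - s) / 2)

theorem rieszConst_pos {d s : ℝ} (hs : s < d) : 0 < rieszConst d s := by
  have := Real.Gamma_pos_of_pos (show 0 < (d - s) / 2 by linarith)
  unfold rieszConst
  positivity

theorem rieszKernel_eq {s : ℝ} (hs : s < Module.finrank ℝ V) {x : V} (hx : x ≠ 0) :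
    rieszKernel s x = ENNReal.ofReal (rieszConst (Module.finrank ℝ V) s) *
      ENNReal.ofReal (‖x‖ ^ (s - Module.finrank ℝ V)) := by
  set d : ℝ := (Module.finrank ℝ V : ℝ) with hd
  have hx' : 0 < ‖x‖ := norm_pos_iff.2 hx
  have ha : 0 < (d - s) / 2 := by linarith
  have hpi := Real.pi_pos
  have h4 : (0 : ℝ) < 4 * Real.pi := by positivity
  have hr : 0 < ‖x‖ ^ 2 / 4 := by positivity
  have key := lintegral_rpow_mul_exp_neg_div_Ioi ha hr
  have h1 : rieszKernel s x = ENNReal.ofReal ((4 * Real.pi) ^ (-d / 2)) *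
      ENNReal.ofReal ((1 / (‖x‖ ^ 2 / 4)) ^ ((d - s) / 2) * Real.Gamma ((d - s) / 2)) := by
    rw [← key, ← lintegral_const_mul' _ _ ENNReal.ofReal_ne_top]
    refine setLIntegral_congr_fun measurableSet_Ioi fun t ht => ?_
    have ht : 0 < t := ht
    rw [← ENNReal.ofReal_mul (by positivity), heatKernel, Real.mul_rpow h4.le ht.le, ← hd]
    congr 1
    rw [show -((d - s) / 2) - 1 = (s / 2 - 1) + -d / 2 by ring, Real.rpow_add ht,
      div_div]
    ring
  rw [h1, ← ENNReal.ofReal_mul (by positivity), ← ENNReal.ofReal_mul (rieszConst_pos hs).le,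
    rieszConst]
  congr 1
  have e1 : (1 / (‖x‖ ^ 2 / 4)) ^ ((d - s) / 2) = 2 ^ (d - s) * ‖x‖ ^ (s - d) := by
    rw [show 1 / (‖x‖ ^ 2 / 4) = (2 * ‖x‖⁻¹) ^ (2 : ℝ) by
      rw [Real.rpow_two]; field_simp; norm_num,
      ← Real.rpow_mul (by positivity), Real.mul_rpow (by norm_num) (by positivity),
      Real.inv_rpow hx'.le, ← Real.rpow_neg hx'.le]
    congr 2 <;> ring
  have e2 : (4 * Real.pi) ^ (-d / 2) = 2 ^ (-d) * Real.pi ^ (-d / 2) := by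
    rw [Real.mul_rpow (by norm_num) hpi.le, show (4 : ℝ) = 2 ^ (2 : ℝ) by norm_num,
      ← Real.rpow_mul (by norm_num)]
    congr 2
    ring
  have e3 : (2 : ℝ) ^ (-s) = 2 ^ (-d) * 2 ^ (d - s) := by
    rw [← Real.rpow_add (by norm_num)]
    congr 1
    ring
  rw [e1, e2, e3]
  ring

/-- The product of two heat kernels in the convolution `h_t ∗ h_τ`, after completing the
square. -/
theorem heatKernel_sub_mul_heatKernel {t τ : ℝ} (ht : 0 < t) (hτ : 0 < τ) (x y : V) :
    heatKernel t (x - y) * heatKernel τ y =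
      heatKernel (t + τ) x * heatKernel (t * τ / (t + τ)) (y - (τ / (t + τ)) • x) := by
  have hpi := Real.pi_pos
  have hs : 0 < t + τ := by positivity
  simp only [heatKernel]
  rw [mul_mul_mul_comm, mul_mul_mul_comm ((4 * Real.pi * (t + τ)) ^ _),
    ← Real.mul_rpow (by positivity) (by positivity),
    ← Real.mul_rpow (by positivity) (by positivity), ← Real.exp_add, ← Real.exp_add]
  congr 2
  · field_simp
  · rw [norm_sub_sq_real, norm_sub_sq_real, norm_smul, Real.norm_of_nonneg (by positivity),
      real_inner_smul_right, real_inner_comm y x]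
    field_simp
    ring

variable [MeasurableSpace V] [BorelSpace V]

theorem measurable_heatKernel : Measurable fun z : ℝ × V => heatKernel z.1 z.2 := by
  unfold heatKernel
  fun_prop

@[fun_prop]
theorem Measurable.heatKernel {Ω : Type*} [MeasurableSpace Ω] {f : Ω → ℝ} {g : Ω → V}
    (hf : Measurable f) (hg : Measurable g) : Measurable fun ω => heatKernel (f ω) (g ω) :=
  measurable_heatKernel.comp (hf.prodMk hg)

theorem measurable_rieszKernel (s : ℝ) : Measurable (rieszKernel s : V → ENNReal) := by
  unfold rieszKernel
  refine Measurable.lintegral_prod_right' (f := fun z : V × ℝ =>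
    ENNReal.ofReal (z.2 ^ (s / 2 - 1) * _root_.heatKernel z.2 z.1)) ?_
  fun_prop

@[fun_prop]
theorem Measurable.rieszKernel (s : ℝ) {Ω : Type*} [MeasurableSpace Ω] {g : Ω → V}
    (hg : Measurable g) : Measurable fun ω => rieszKernel s (g ω) :=
  (measurable_rieszKernel s).comp hg

variable [FiniteDimensional ℝ V]

theorem integrable_exp_neg_mul_sq_norm {b : ℝ} (hb : 0 < b) :
    Integrable fun v : V => Real.exp (-b * ‖v‖ ^ 2) := by
  have h := (GaussianFourier.integrable_cexp_neg_mul_sq_norm_add (V := V) (b := b)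
    (by simpa using hb) 0 0).norm
  simpa [Complex.norm_exp, ← Complex.ofReal_pow] using h

theorem integrable_heatKernel {t : ℝ} (ht : 0 < t) : Integrable (heatKernel t : V → ℝ) := by
  have h := (integrable_exp_neg_mul_sq_norm (V := V) (b := 1 / (4 * t)) (by positivity)).const_mul
    ((4 * Real.pi * t) ^ (-(Module.finrank ℝ V : ℝ) / 2))
  refine h.congr (Filter.Eventually.of_forall fun v => ?_)
  simp only [heatKernel]
  congr 2
  ring

theorem lintegral_heatKernel {t : ℝ} (ht : 0 < t) :
    ∫⁻ x : V, ENNReal.ofReal (heatKernel t x) = 1 := by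
  rw [← ofReal_integral_eq_lintegral_ofReal (integrable_heatKernel ht)
    (Filter.Eventually.of_forall (heatKernel_nonneg ht)), ← ENNReal.ofReal_one]
  congr 1
  have hpi := Real.pi_pos
  have h := GaussianFourier.integral_rexp_neg_mul_sq_norm (V := V) (b := 1 / (4 * t))
    (by positivity)
  simp only [heatKernel]
  rw [integral_const_mul]
  have e : (fun v : V => Real.exp (-(‖v‖ ^ 2 / (4 * t)))) =
      fun v => Real.exp (-(1 / (4 * t)) * ‖v‖ ^ 2) := by
    ext v
    congr 1
    ring
  rw [e, h, show Real.pi / (1 / (4 * t)) = 4 * Real.pi * t by field_simp,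
    ← Real.rpow_add (by positivity)]
  ring_nf
  simp

theorem lintegral_heatKernel_sub_mul_heatKernel {t τ : ℝ} (ht : 0 < t) (hτ : 0 < τ) (x : V) :
    ∫⁻ y, ENNReal.ofReal (heatKernel t (x - y)) * ENNReal.ofReal (heatKernel τ y) =
      ENNReal.ofReal (heatKernel (t + τ) x) := by
  have e : ∀ y : V, ENNReal.ofReal (heatKernel t (x - y)) * ENNReal.ofReal (heatKernel τ y) =
      ENNReal.ofReal (heatKernel (t + τ) x) *
        ENNReal.ofReal (heatKernel (t * τ / (t + τ)) (y - (τ / (t + τ)) • x)) := fun y => by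
    rw [← ENNReal.ofReal_mul (heatKernel_nonneg ht _), heatKernel_sub_mul_heatKernel ht hτ,
      ENNReal.ofReal_mul (heatKernel_nonneg (by positivity) _)]
  simp_rw [e]
  rw [lintegral_const_mul _ (by fun_prop), lintegral_sub_right_eq_self
    (fun y : V => ENNReal.ofReal (heatKernel (t * τ / (t + τ)) y)),
    lintegral_heatKernel (by positivity), mul_one]

/-- The semigroup law `I_a ∗ I_b = I_{a+b}` of the Riesz kernels, which here carry factors
`Γ(a/2)`, `Γ(b/2)` and `Γ((a+b)/2)`. It is inherited from the heat semigroup. -/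
theorem lintegral_rieszKernel_sub_mul_rieszKernel {a b : ℝ} (ha : 0 < a) (hb : 0 < b) (x : V) :
    ∫⁻ y, rieszKernel a (x - y) * rieszKernel b y =
      ENNReal.ofReal (Real.Gamma (a / 2) * Real.Gamma (b / 2) / Real.Gamma ((a + b) / 2)) *
        rieszKernel (a + b) x := by
  set φ : ℝ → ℝ → V → ENNReal := fun t τ y =>
    ENNReal.ofReal (t ^ (a / 2 - 1) * τ ^ (b / 2 - 1)) *
      (ENNReal.ofReal (heatKernel t (x - y)) * ENNReal.ofReal (heatKernel τ y)) with hφ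
  have hprod : ∀ y, rieszKernel a (x - y) * rieszKernel b y =
      ∫⁻ t in Set.Ioi (0 : ℝ), ∫⁻ τ in Set.Ioi (0 : ℝ), φ t τ y := by
    intro y
    unfold rieszKernel
    rw [← lintegral_mul_const _ (by fun_prop)]
    refine setLIntegral_congr_fun measurableSet_Ioi fun t ht => ?_
    have ht : 0 < t := ht
    rw [← lintegral_const_mul _ (by fun_prop)]
    refine setLIntegral_congr_fun measurableSet_Ioi fun τ hτ => ?_
    have hτ : 0 < τ := hτ
    simp only [hφ]
    rw [ENNReal.ofReal_mul (by positivity), ENNReal.ofReal_mul (by positivity),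
      ENNReal.ofReal_mul (by positivity)]
    ring
  simp_rw [hprod]
  rw [lintegral_lintegral_swap (by
    refine (Measurable.lintegral_prod_right' (f := fun z : (V × ℝ) × ℝ => φ z.1.2 z.2 z.1.1)
      ?_).aemeasurable
    simp only [hφ]
    fun_prop)]
  have hinner : ∀ t ∈ Set.Ioi (0 : ℝ),
      ∫⁻ y, ∫⁻ τ in Set.Ioi (0 : ℝ), φ t τ y = ∫⁻ τ in Set.Ioi (0 : ℝ),
        ENNReal.ofReal (t ^ (a / 2 - 1) * τ ^ (b / 2 - 1)) *
          ENNReal.ofReal (heatKernel (t + τ) x) := by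
    intro t ht
    rw [lintegral_lintegral_swap (by
      refine Measurable.aemeasurable ?_
      simp only [hφ, Function.uncurry_def]
      fun_prop)]
    refine setLIntegral_congr_fun measurableSet_Ioi fun τ hτ => ?_
    simp only [hφ]
    rw [lintegral_const_mul _ (by fun_prop), lintegral_heatKernel_sub_mul_heatKernel ht hτ]
  rw [setLIntegral_congr_fun measurableSet_Ioi hinner,
    lintegral_rpow_mul_rpow_mul_comp_add (half_pos ha) (half_pos hb)
      (F := fun r => ENNReal.ofReal (heatKernel r x)) (by fun_prop), ← add_div, rieszKernel]
  congr 1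
  refine setLIntegral_congr_fun measurableSet_Ioi fun r hr => ?_
  exact (ENNReal.ofReal_mul (Real.rpow_nonneg (le_of_lt hr) _)).symm

/-- The Riesz potential of a power of the norm. -/
theorem lintegral_rieszKernel_sub_mul_norm_rpow {a b : ℝ} (ha : 0 < a) (hb : 0 < b)
    (hab : a + b < Module.finrank ℝ V) {x : V} (hx : x ≠ 0) :
    ∫⁻ y, rieszKernel a (x - y) * ENNReal.ofReal (‖y‖ ^ (b - Module.finrank ℝ V)) =
      ENNReal.ofReal (Real.Gamma (a / 2) * (2 ^ (-a) *
        (Real.Gamma (b / 2) * Real.Gamma ((Module.finrank ℝ V - a - b) / 2) /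
          (Real.Gamma ((a + b) / 2) * Real.Gamma ((Module.finrank ℝ V - b) / 2))))) *
        ENNReal.ofReal (‖x‖ ^ (a + b - Module.finrank ℝ V)) := by
  have : Nontrivial V := ⟨x, 0, hx⟩
  set d : ℝ := (Module.finrank ℝ V : ℝ) with hd
  have hcb : 0 < rieszConst d b := rieszConst_pos (by linarith)
  have hne : ∀ᵐ y : V, y ≠ 0 := Measure.ae_ne volume 0
  have h := lintegral_rieszKernel_sub_mul_rieszKernel ha hb x
  have hleft : ∫⁻ y, rieszKernel a (x - y) * rieszKernel b y = ENNReal.ofReal (rieszConst d b) *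
      ∫⁻ y, rieszKernel a (x - y) * ENNReal.ofReal (‖y‖ ^ (b - d)) := by
    rw [← lintegral_const_mul _ (by fun_prop)]
    refine lintegral_congr_ae ?_
    filter_upwards [hne] with y hy
    rw [rieszKernel_eq (by linarith) hy]
    ring
  have hG := Real.Gamma_pos_of_pos (half_pos ha)
  have hG2 := Real.Gamma_pos_of_pos (half_pos hb)
  have hG3 := Real.Gamma_pos_of_pos (show 0 < (a + b) / 2 by linarith)
  have hG4 := Real.Gamma_pos_of_pos (show 0 < (d - b) / 2 by linarith)
  have hG5 := Real.Gamma_pos_of_pos (show 0 < (d - a - b) / 2 by linarith)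
  rw [hleft, rieszKernel_eq (by linarith) hx, ← hd, ← mul_assoc] at h
  rw [← ENNReal.mul_right_inj (a := ENNReal.ofReal (rieszConst d b)) (by simpa using hcb)
    ENNReal.ofReal_ne_top, h, ← mul_assoc, ← ENNReal.ofReal_mul (by positivity),
    ← ENNReal.ofReal_mul hcb.le]
  congr 2
  rw [rieszConst, rieszConst, neg_add, Real.rpow_add two_pos, ← sub_sub]
  field_simp

end Kernels

/-! ### Schur's test -/

/-- **Schur's test**: if `∫ K(x, y) w(y)^q dy ≤ B u(x)^q` and `∫ K(x, y) u(x)^p dx ≤ B w(y)^p` for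
weights `u`, `w`, then the integral operator with the nonnegative kernel `K` has norm at most `B`
on `L^p`. -/
theorem lintegral_rpow_lintegral_mul_le_of_schur {X Y : Type*} [MeasurableSpace X]
    [MeasurableSpace Y] {μ : Measure X} {ν : Measure Y} [SFinite μ] [SFinite ν] {p q : ℝ}
    (hpq : p.HolderConjugate q) {K : X → Y → ENNReal} (hK : Measurable (Function.uncurry K))
    {u : X → ENNReal} {w : Y → ENNReal} (hu : Measurable u) (hw : Measurable w)
    (hw0 : ∀ᵐ y ∂ν, w y ≠ 0) (hw1 : ∀ᵐ y ∂ν, w y ≠ ⊤) {B : ENNReal}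
    (h₁ : ∀ᵐ x ∂μ, ∫⁻ y, K x y * w y ^ q ∂ν ≤ B * u x ^ q)
    (h₂ : ∀ᵐ y ∂ν, ∫⁻ x, K x y * u x ^ p ∂μ ≤ B * w y ^ p)
    {h : Y → ENNReal} (hh : Measurable h) :
    ∫⁻ x, (∫⁻ y, K x y * h y ∂ν) ^ p ∂μ ≤ B ^ p * ∫⁻ y, h y ^ p ∂ν := by
  have hp : 0 < p := hpq.pos
  have hq : 0 < q := hpq.symm.pos
  have hKx : ∀ x, Measurable (K x) := fun x => hK.of_uncurry_left
  have hKu : Measurable fun z : X × Y => K z.1 z.2 := hK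
  have hKy : ∀ y, Measurable fun x => K x y := fun y => hK.of_uncurry_right
  have hpw : ∀ᵐ x ∂μ, (∫⁻ y, K x y * h y ∂ν) ^ p ≤
      B ^ (p / q) * ∫⁻ y, u x ^ p * (K x y * ((w y)⁻¹ * h y) ^ p) ∂ν := by
    filter_upwards [h₁] with x hx
    have hKx' := hKx x
    -- Split `K h = (K ^ (1/q) w) (K ^ (1/p) w⁻¹ h)` and apply Hölder's inequality.
    have hsplit : ∫⁻ y, K x y * h y ∂ν = ∫⁻ y, ((fun y => K x y ^ (1 / p) * ((w y)⁻¹ * h y)) *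
        fun y => K x y ^ (1 / q) * w y) y ∂ν := by
      refine lintegral_congr_ae ?_
      filter_upwards [hw0, hw1] with y hy0 hy1
      have e : K x y = K x y ^ (1 / p) * K x y ^ (1 / q) := by
        rw [← ENNReal.rpow_add_of_nonneg _ _ (by positivity) (by positivity), one_div, one_div,
          hpq.inv_add_inv_eq_one, ENNReal.rpow_one]
      have e' : (w y)⁻¹ * w y = 1 := ENNReal.inv_mul_cancel hy0 hy1
      calc K x y * h y = K x y * h y * ((w y)⁻¹ * w y) := by rw [e', mul_one]
        _ = K x y ^ (1 / p) * K x y ^ (1 / q) * h y * ((w y)⁻¹ * w y) := by rw [← e]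
        _ = _ := by
          simp only [Pi.mul_apply]
          ring
    have hhol := ENNReal.lintegral_mul_le_Lp_mul_Lq ν hpq
      (f := fun y => K x y ^ (1 / p) * ((w y)⁻¹ * h y)) (g := fun y => K x y ^ (1 / q) * w y)
      (by fun_prop) (by fun_prop)
    rw [← hsplit] at hhol
    have e1 : ∀ y, (K x y ^ (1 / p) * ((w y)⁻¹ * h y)) ^ p = K x y * ((w y)⁻¹ * h y) ^ p := by
      intro y
      rw [ENNReal.mul_rpow_of_nonneg _ _ hp.le, ← ENNReal.rpow_mul, one_div_mul_cancel hp.ne',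
        ENNReal.rpow_one]
    have e2 : ∀ y, (K x y ^ (1 / q) * w y) ^ q = K x y * w y ^ q := by
      intro y
      rw [ENNReal.mul_rpow_of_nonneg _ _ hq.le, ← ENNReal.rpow_mul, one_div_mul_cancel hq.ne',
        ENNReal.rpow_one]
    simp_rw [e1, e2] at hhol
    calc (∫⁻ y, K x y * h y ∂ν) ^ p
        ≤ ((∫⁻ y, K x y * ((w y)⁻¹ * h y) ^ p ∂ν) ^ (1 / p) *
            (∫⁻ y, K x y * w y ^ q ∂ν) ^ (1 / q)) ^ p := by gcongr
      _ ≤ ((∫⁻ y, K x y * ((w y)⁻¹ * h y) ^ p ∂ν) ^ (1 / p) * (B * u x ^ q) ^ (1 / q)) ^ p := by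
          gcongr
      _ = B ^ (p / q) * (u x ^ p * ∫⁻ y, K x y * ((w y)⁻¹ * h y) ^ p ∂ν) := by
          rw [ENNReal.mul_rpow_of_nonneg _ _ hp.le, ← ENNReal.rpow_mul, one_div_mul_cancel hp.ne',
            ENNReal.rpow_one, ENNReal.mul_rpow_of_nonneg _ _ (by positivity), ← ENNReal.rpow_mul,
            mul_one_div_cancel hq.ne', ENNReal.rpow_one, ENNReal.mul_rpow_of_nonneg _ _ hp.le,
            ← ENNReal.rpow_mul, one_div_mul_eq_div]
          ring
      _ = _ := by rw [lintegral_const_mul _ (by fun_prop)]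
  calc ∫⁻ x, (∫⁻ y, K x y * h y ∂ν) ^ p ∂μ
      ≤ ∫⁻ x, B ^ (p / q) * ∫⁻ y, u x ^ p * (K x y * ((w y)⁻¹ * h y) ^ p) ∂ν ∂μ :=
        lintegral_mono_ae hpw
    _ = B ^ (p / q) * ∫⁻ y, ∫⁻ x, u x ^ p * (K x y * ((w y)⁻¹ * h y) ^ p) ∂μ ∂ν := by
        rw [lintegral_const_mul, lintegral_lintegral_swap]
        · refine Measurable.aemeasurable ?_
          simp only [Function.uncurry_def]
          fun_prop
        · refine Measurable.lintegral_prod_right'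
            (f := fun z : X × Y => u z.1 ^ p * (K z.1 z.2 * ((w z.2)⁻¹ * h z.2) ^ p)) ?_
          fun_prop
    _ ≤ B ^ (p / q) * ∫⁻ y, B * h y ^ p ∂ν := by
        gcongr 1
        refine lintegral_mono_ae ?_
        filter_upwards [h₂, hw0, hw1] with y hy hy0 hy1
        have hKy' := hKy y
        calc ∫⁻ x, u x ^ p * (K x y * ((w y)⁻¹ * h y) ^ p) ∂μ
            = (∫⁻ x, K x y * u x ^ p ∂μ) * ((w y)⁻¹ * h y) ^ p := by
              rw [← lintegral_mul_const _ (by fun_prop)]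
              refine lintegral_congr fun x => ?_
              ring
          _ ≤ B * w y ^ p * ((w y)⁻¹ * h y) ^ p := by gcongr
          _ = B * h y ^ p := by
              rw [mul_assoc, ← ENNReal.mul_rpow_of_nonneg _ _ hp.le, ← mul_assoc,
                ENNReal.mul_inv_cancel hy0 hy1, one_mul]
    _ = B ^ p * ∫⁻ y, h y ^ p ∂ν := by
        have e : p = p / q + 1 := by
          have := hpq.inv_add_inv_eq_one
          field_simp at this ⊢
          linarith
        rw [lintegral_const_mul _ (by fun_prop), ← mul_assoc]
        conv_rhs => rw [e, ENNReal.rpow_add_of_nonneg _ _ (by positivity) zero_le_one,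
          ENNReal.rpow_one, ← e]

/-! ### Functions as Riesz potentials of their fractional Laplacians -/

section Potential

variable {V : Type*} [NormedAddCommGroup V] [InnerProductSpace ℝ V] [FiniteDimensional ℝ V]
  [MeasurableSpace V] [BorelSpace V]

theorem enorm_complex_ofReal (r : ℝ) : ‖(r : ℂ)‖ₑ = ‖r‖ₑ := by
  simp [← ofReal_norm]

theorem continuous_fourierInv_of_integrable {F : V → ℂ} (hF : Integrable F) :
    Continuous (𝓕⁻ F) := by
  have h : 𝓕⁻ F = fun y => 𝓕 F (-y) := funext fun y => Real.fourierInv_eq_fourier_neg F y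
  rw [h]
  exact (VectorFourier.fourierIntegral_continuous Real.continuous_fourierChar (L := innerₗ V)
    continuous_inner hF).comp continuous_neg

theorem fourier_heatKernel {t : ℝ} (ht : 0 < t) (ξ : V) :
    𝓕 (fun y : V => (heatKernel t y : ℂ)) ξ =
      (Real.exp (-((2 * Real.pi * ‖ξ‖) ^ 2 * t)) : ℝ) := by
  have hpi := Real.pi_pos
  have hb : 0 < 1 / (4 * t) := by positivity
  have h := fourier_gaussian_innerProductSpace (V := V) (b := ((1 / (4 * t) : ℝ) : ℂ))
    (by simpa using hb) ξ
  have e : (fun y : V => (heatKernel t y : ℂ)) = fun y =>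
      (((4 * Real.pi * t) ^ (-(Module.finrank ℝ V : ℝ) / 2) : ℝ) : ℂ) •
        Complex.exp (-((1 / (4 * t) : ℝ) : ℂ) * ‖y‖ ^ 2) := by
    ext y
    simp only [heatKernel, Complex.ofReal_mul, smul_eq_mul, Complex.ofReal_exp]
    congr 2
    push_cast
    ring
  have e2 : ((Real.pi : ℂ) / ((1 / (4 * t) : ℝ) : ℂ)) ^ (Module.finrank ℝ V / 2 : ℂ) =
      (((4 * Real.pi * t) ^ ((Module.finrank ℝ V : ℝ) / 2) : ℝ) : ℂ) := by
    rw [Complex.ofReal_cpow (by positivity)]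
    push_cast
    congr 1
    field_simp
  rw [e, Real.fourier_eq]
  simp_rw [smul_comm _ ((_ : ℝ) : ℂ)]
  rw [integral_smul, ← Real.fourier_eq, h, e2, smul_eq_mul, ← mul_assoc, ← Complex.ofReal_mul,
    ← Real.rpow_add (by positivity), neg_div, neg_add_cancel, Real.rpow_zero, Complex.ofReal_one,
    one_mul, Complex.ofReal_exp]
  congr 1
  push_cast
  field_simp
  ring

/-- The heat semigroup acts on the Fourier side as multiplication by `exp (-4π²|ξ|²t)`. -/
theorem integral_heatKernel_sub_mul_fourierInv {F : V → ℂ} (hF : Integrable F) {t : ℝ}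
    (ht : 0 < t) (x : V) :
    ∫ y, (heatKernel t (x - y) : ℂ) * 𝓕⁻ F y =
      ∫ ξ, ((Real.exp (-((2 * Real.pi * ‖ξ‖) ^ 2 * t)) : ℝ) : ℂ) *
        (Real.fourierChar (inner ℝ ξ x) • F ξ) := by
  have hint : Integrable fun y : V => (heatKernel t (y + x) : ℂ) :=
    ((integrable_heatKernel ht).comp_add_right x).ofReal
  have hflip : ∫ ξ, 𝓕 F ξ • (heatKernel t (ξ + x) : ℂ) =
      ∫ ξ, F ξ • 𝓕 (fun y : V => (heatKernel t (y + x) : ℂ)) ξ := by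
    have := VectorFourier.integral_fourierIntegral_smul_eq_flip (L := innerₗ V) (μ := volume)
      (ν := volume) Real.continuous_fourierChar continuous_inner hF hint
    simpa using! this
  have hshift : ∀ ξ, 𝓕 (fun y : V => (heatKernel t (y + x) : ℂ)) ξ =
      Real.fourierChar (inner ℝ x ξ) • 𝓕 (fun y : V => (heatKernel t y : ℂ)) ξ := fun ξ =>
    congrFun (VectorFourier.fourierIntegral_comp_add_right Real.fourierChar volume (innerₗ V)
      (fun y : V => (heatKernel t y : ℂ)) x) ξ
  rw [← integral_neg_eq_self]
  simp_rw [Real.fourierInv_eq_fourier_neg, neg_neg, sub_neg_eq_add, add_comm x,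
    mul_comm (heatKernel t _ : ℂ), ← smul_eq_mul]
  rw [hflip]
  refine integral_congr_ae (Filter.Eventually.of_forall fun ξ => ?_)
  simp only [hshift, fourier_heatKernel ht, real_inner_comm ξ x, Circle.smul_def, smul_eq_mul]
  ring

theorem lintegral_rpow_mul_exp_neg_frequency [Nontrivial V] {s : ℝ} (hs : 0 < s) :
    ∀ᵐ ξ : V, ∫⁻ t in Set.Ioi (0 : ℝ), ENNReal.ofReal
      (t ^ (s / 2 - 1) * Real.exp (-((2 * Real.pi * ‖ξ‖) ^ 2 * t))) =
        ENNReal.ofReal ((2 * Real.pi * ‖ξ‖) ^ (-s) * Real.Gamma (s / 2)) := by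
  filter_upwards [Measure.ae_ne volume (0 : V)] with ξ hξ
  have hpi := Real.pi_pos
  have hξ' : 0 < ‖ξ‖ := norm_pos_iff.2 hξ
  rw [lintegral_rpow_mul_exp_neg_mul_Ioi (half_pos hs) (by positivity)]
  congr 2
  rw [one_div, Real.inv_rpow (by positivity), ← Real.rpow_natCast, ← Real.rpow_mul (by positivity),
    ← Real.rpow_neg (by positivity)]
  congr 1
  push_cast
  ring

theorem integral_rpow_mul_exp_neg_frequency [Nontrivial V] {s : ℝ} (hs : 0 < s) :
    ∀ᵐ ξ : V, ∫ t in Set.Ioi (0 : ℝ),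
      t ^ (s / 2 - 1) * Real.exp (-((2 * Real.pi * ‖ξ‖) ^ 2 * t)) =
        (2 * Real.pi * ‖ξ‖) ^ (-s) * Real.Gamma (s / 2) := by
  filter_upwards [lintegral_rpow_mul_exp_neg_frequency (V := V) hs] with ξ hξ
  have hpi := Real.pi_pos
  have hG := Real.Gamma_pos_of_pos (half_pos hs)
  rw [integral_eq_lintegral_of_nonneg_ae, hξ, ENNReal.toReal_ofReal (by positivity)]
  · filter_upwards [ae_restrict_mem measurableSet_Ioi] with t ht
    have : 0 < t := ht
    positivity
  · exact Measurable.aestronglyMeasurable (by fun_prop)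

/-- If `f` has the Fourier transform `(2π|ξ|)^s G(ξ)`, then the function with the Fourier
transform `G` is dominated by the Riesz potential of order `s` of `|f|`. Passing to absolute
values inside `∫₀^∞ t^(s/2-1) exp (tΔ) f dt` makes any decay of `f` at infinity unnecessary. -/
theorem ofReal_Gamma_mul_enorm_fourierInv_le [Nontrivial V] {s : ℝ} (hs : 0 < s) {G : V → ℂ}
    (hG : Integrable G)
    (hF : Integrable fun ξ : V => (((2 * Real.pi * ‖ξ‖) ^ s : ℝ) : ℂ) * G ξ) (x : V) :
    ENNReal.ofReal (Real.Gamma (s / 2)) * ‖𝓕⁻ G x‖ₑ ≤ ∫⁻ y, rieszKernel s (x - y) *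
      ‖𝓕⁻ (fun ξ : V => (((2 * Real.pi * ‖ξ‖) ^ s : ℝ) : ℂ) * G ξ) y‖ₑ := by
  set F : V → ℂ := fun ξ => (((2 * Real.pi * ‖ξ‖) ^ s : ℝ) : ℂ) * G ξ with hFdef
  have hpi := Real.pi_pos
  have hΓ := Real.Gamma_pos_of_pos (half_pos hs)
  set φ : ℝ → V → ℝ := fun t ξ =>
    t ^ (s / 2 - 1) * Real.exp (-((2 * Real.pi * ‖ξ‖) ^ 2 * t)) with hφ
  have hφ0 : ∀ t ∈ Set.Ioi (0 : ℝ), ∀ ξ, 0 ≤ φ t ξ := fun t ht ξ => by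
    have : 0 < t := ht
    simp only [hφ]
    positivity
  set Φ : ℝ → V → ℂ := fun t ξ => (φ t ξ : ℂ) * (Real.fourierChar (inner ℝ ξ x) • F ξ) with hΦ
  have hne : ∀ᵐ ξ : V, ξ ≠ 0 := Measure.ae_ne volume 0
  have hcancel : ∀ ξ : V, ξ ≠ 0 →
      ((((2 * Real.pi * ‖ξ‖) ^ (-s) * Real.Gamma (s / 2) : ℝ) : ℝ) : ℂ) * F ξ =
        (Real.Gamma (s / 2) : ℂ) * G ξ := fun ξ hξ => by
    have hξ' : 0 < 2 * Real.pi * ‖ξ‖ := by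
      have := norm_pos_iff.2 hξ
      positivity
    have : (2 * Real.pi * ‖ξ‖) ^ (-s) * (2 * Real.pi * ‖ξ‖) ^ s = 1 := by
      rw [← Real.rpow_add hξ']
      simp
    simp only [hFdef]
    rw [← mul_assoc, ← Complex.ofReal_mul, mul_right_comm, this, one_mul]
  have hΦm : AEStronglyMeasurable (Function.uncurry Φ)
      ((volume.restrict (Set.Ioi (0 : ℝ))).prod (volume : Measure V)) := by
    simp only [hΦ, Function.uncurry_def]
    refine AEStronglyMeasurable.mul ?_ ?_
    · refine Measurable.aestronglyMeasurable ?_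
      simp only [hφ]
      fun_prop
    · refine AEStronglyMeasurable.smul
        (f := fun z : ℝ × V => Real.fourierChar (inner ℝ z.2 x)) ?_ hF.1.comp_snd
      refine Continuous.aestronglyMeasurable ?_
      exact Real.continuous_fourierChar.comp (continuous_snd.inner continuous_const)
  have hΦi : Integrable (Function.uncurry Φ)
      ((volume.restrict (Set.Ioi (0 : ℝ))).prod (volume : Measure V)) := by
    refine ⟨hΦm, ?_⟩
    rw [HasFiniteIntegral, lintegral_prod_symm _ hΦm.enorm]
    have e : ∀ᵐ ξ : V, ∫⁻ t in Set.Ioi (0 : ℝ), ‖Function.uncurry Φ (t, ξ)‖ₑ =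
        ENNReal.ofReal (Real.Gamma (s / 2)) * ‖G ξ‖ₑ := by
      filter_upwards [lintegral_rpow_mul_exp_neg_frequency (V := V) hs, hne] with ξ hξ hξ0
      have e1 : ∫⁻ t in Set.Ioi (0 : ℝ), ‖Function.uncurry Φ (t, ξ)‖ₑ =
          ∫⁻ t in Set.Ioi (0 : ℝ), ENNReal.ofReal (φ t ξ) * ‖F ξ‖ₑ := by
        refine setLIntegral_congr_fun measurableSet_Ioi fun t ht => ?_
        simp only [hΦ, Function.uncurry_apply_pair]
        rw [enorm_mul, ← Real.enorm_of_nonneg (hφ0 t ht ξ), enorm_complex_ofReal]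
        congr 1
        rw [← ofReal_norm, Circle.norm_smul, ofReal_norm]
      rw [e1, lintegral_mul_const _ (by simp only [hφ]; fun_prop)]
      simp only [hφ]
      rw [hξ, ← Real.enorm_of_nonneg (by positivity), ← Real.enorm_of_nonneg hΓ.le,
        ← enorm_complex_ofReal, ← enorm_mul, hcancel ξ hξ0, enorm_mul, enorm_complex_ofReal]
    rw [lintegral_congr_ae e, lintegral_const_mul' _ _ ENNReal.ofReal_ne_top]
    exact ENNReal.mul_lt_top ENNReal.ofReal_lt_top hG.2
  have hrep : (Real.Gamma (s / 2) : ℂ) * 𝓕⁻ G x =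
      ∫ t in Set.Ioi (0 : ℝ), ∫ ξ, Φ t ξ := by
    rw [integral_integral_swap hΦi, Real.fourierInv_eq, ← integral_const_mul]
    refine integral_congr_ae ?_
    filter_upwards [integral_rpow_mul_exp_neg_frequency (V := V) hs, hne] with ξ hξ hξ0
    simp only [hΦ]
    rw [integral_mul_const, integral_complex_ofReal, hξ, mul_smul_comm, mul_smul_comm,
      hcancel ξ hξ0]
  have hslice : ∀ t ∈ Set.Ioi (0 : ℝ), ‖∫ ξ, Φ t ξ‖ₑ ≤
      ∫⁻ y, ENNReal.ofReal (t ^ (s / 2 - 1) * heatKernel t (x - y)) * ‖𝓕⁻ F y‖ₑ := fun t ht => by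
    have ht' : 0 < t := ht
    have e : ∫ ξ, Φ t ξ =
        ∫ y, ((t ^ (s / 2 - 1) * heatKernel t (x - y) : ℝ) : ℂ) * 𝓕⁻ F y := by
      simp only [hΦ, hφ, Complex.ofReal_mul _ (heatKernel _ _),
        Complex.ofReal_mul _ (Real.exp _), mul_assoc (((_ : ℝ) : ℂ))]
      rw [integral_const_mul, integral_const_mul, integral_heatKernel_sub_mul_fourierInv hF ht']
    rw [e]
    refine (enorm_integral_le_lintegral_enorm _).trans_eq (lintegral_congr fun y => ?_)
    rw [enorm_mul, enorm_complex_ofReal, Real.enorm_of_nonneg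
      (mul_nonneg (by positivity) (heatKernel_nonneg ht' _))]
  have hcm : Measurable (𝓕⁻ F) := (continuous_fourierInv_of_integrable hF).measurable
  calc ENNReal.ofReal (Real.Gamma (s / 2)) * ‖𝓕⁻ G x‖ₑ
      = ‖∫ t in Set.Ioi (0 : ℝ), ∫ ξ, Φ t ξ‖ₑ := by
        rw [← hrep, enorm_mul, enorm_complex_ofReal, Real.enorm_of_nonneg hΓ.le]
    _ ≤ ∫⁻ t in Set.Ioi (0 : ℝ), ‖∫ ξ, Φ t ξ‖ₑ := enorm_integral_le_lintegral_enorm _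
    _ ≤ ∫⁻ t in Set.Ioi (0 : ℝ), ∫⁻ y,
          ENNReal.ofReal (t ^ (s / 2 - 1) * heatKernel t (x - y)) * ‖𝓕⁻ F y‖ₑ :=
        setLIntegral_mono' measurableSet_Ioi hslice
    _ = ∫⁻ y, rieszKernel s (x - y) * ‖𝓕⁻ F y‖ₑ := by
        rw [lintegral_lintegral_swap]
        · refine lintegral_congr fun y => ?_
          rw [lintegral_mul_const _ (by fun_prop), rieszKernel]
        · refine Measurable.aemeasurable ?_
          simp only [Function.uncurry_def]
          fun_prop

end Potential

/-! ### The Stein–Weiss inequality -/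

section SteinWeiss

variable {V : Type*} [NormedAddCommGroup V] [InnerProductSpace ℝ V]

/-- The kernel `|x|^(-α) k(x - y) |y|^(-β)`, with `k` the Riesz kernel of order `α + β` multiplied
by `Γ((α + β)/2)`. It is homogeneous of degree `-d`, where `d` is the dimension. -/
noncomputable def steinWeissKernel (α β : ℝ) (x y : V) : ENNReal :=
  ENNReal.ofReal (‖x‖ ^ (-α)) * rieszKernel (α + β) (x - y) * ENNReal.ofReal (‖y‖ ^ (-β))

theorem steinWeissKernel_comm (α β : ℝ) (x y : V) :
    steinWeissKernel α β x y = steinWeissKernel β α y x := by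
  rw [steinWeissKernel, steinWeissKernel, rieszKernel_sub_comm, add_comm α β]
  ring

variable [FiniteDimensional ℝ V] [MeasurableSpace V] [BorelSpace V]

/-- The homogeneous function `|y|^(-d/p)` is an eigenfunction of the Stein–Weiss operator. The
eigenvalue is `Γ((α + β)/2)` times the constant `hardyRellichConst` of the inequality. -/
theorem lintegral_steinWeissKernel_mul_norm_rpow {d α β p q : ℝ} (hd : d = Module.finrank ℝ V)
    (hpq : 1 / p + 1 / q = 1) (hs : 0 < α + β) (hα : α < d / p) (hβ : β < d / q) {x : V}
    (hx : x ≠ 0) :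
    ∫⁻ y, steinWeissKernel α β x y * ENNReal.ofReal (‖y‖ ^ (-d / p)) =
      ENNReal.ofReal (Real.Gamma ((α + β) / 2) * (2 ^ (-(α + β)) *
        ((Real.Gamma (d / (2 * p) - α / 2) * Real.Gamma (d / (2 * q) - β / 2)) /
          (Real.Gamma (d / (2 * q) + α / 2) * Real.Gamma (d / (2 * p) + β / 2))))) *
        ENNReal.ofReal (‖x‖ ^ (-d / p)) := by
  have : Nontrivial V := ⟨x, 0, hx⟩
  have hx' : 0 < ‖x‖ := norm_pos_iff.2 hx
  have hdpq : d / p + d / q = d := by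
    rw [div_eq_mul_one_div, div_eq_mul_one_div d q, ← mul_add, hpq, mul_one]
  have hp2 : d / (2 * p) = d / p / 2 := by rw [div_div, mul_comm p]
  have hq2 : d / (2 * q) = d / q / 2 := by rw [div_div, mul_comm q]
  have e : ∫⁻ y, steinWeissKernel α β x y * ENNReal.ofReal (‖y‖ ^ (-d / p)) =
      ENNReal.ofReal (‖x‖ ^ (-α)) * ∫⁻ y, rieszKernel (α + β) (x - y) *
        ENNReal.ofReal (‖y‖ ^ ((d / q - β) - Module.finrank ℝ V)) := by
    rw [← lintegral_const_mul _ (by fun_prop)]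
    refine lintegral_congr_ae ?_
    filter_upwards [Measure.ae_ne volume (0 : V)] with y hy
    have hy' : 0 < ‖y‖ := norm_pos_iff.2 hy
    rw [steinWeissKernel, mul_assoc, mul_assoc, ← ENNReal.ofReal_mul (by positivity),
      ← Real.rpow_add hy', ← hd]
    rw [neg_div, show -β + -(d / p) = d / q - β - d by linarith]
  rw [e, lintegral_rieszKernel_sub_mul_norm_rpow hs (by linarith) (by rw [← hd]; linarith) hx,
    ← hd, mul_left_comm, ← ENNReal.ofReal_mul (by positivity), ← Real.rpow_add hx']
  congr 2
  · rw [hp2, hq2, show (d - (α + β) - (d / q - β)) / 2 = d / p / 2 - α / 2 by linarith,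
      show (d / q - β) / 2 = d / q / 2 - β / 2 by ring,
      show (α + β + (d / q - β)) / 2 = d / q / 2 + α / 2 by ring,
      show (d - (d / q - β)) / 2 = d / p / 2 + β / 2 by linarith,
      mul_comm (Real.Gamma (d / q / 2 - β / 2))]
  · congr 1
    rw [neg_div]
    linarith

/-- The **Stein–Weiss inequality** on `L^p`. Schur's test applies with the weights
`|x|^(-d/(pq))`, whose powers `|x|^(-d/p)` and `|x|^(-d/q)` are eigenfunctions of the operator and
of its transpose with the same eigenvalue. -/
theorem lintegral_rpow_lintegral_steinWeissKernel_le [Nontrivial V] {d α β p q : ℝ}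
    (hd : d = Module.finrank ℝ V) (hpq : p.HolderConjugate q) (hs : 0 < α + β)
    (hα : α < d / p) (hβ : β < d / q) {h : V → ENNReal} (hh : Measurable h) :
    ∫⁻ x, (∫⁻ y, steinWeissKernel α β x y * h y) ^ p ≤
      ENNReal.ofReal (Real.Gamma ((α + β) / 2) * (2 ^ (-(α + β)) *
        ((Real.Gamma (d / (2 * p) - α / 2) * Real.Gamma (d / (2 * q) - β / 2)) /
          (Real.Gamma (d / (2 * q) + α / 2) * Real.Gamma (d / (2 * p) + β / 2))))) ^ p *
        ∫⁻ y, h y ^ p := by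
  have hp : 0 < p := hpq.pos
  have hq : 0 < q := hpq.symm.pos
  have hpq1 : 1 / p + 1 / q = 1 := by simpa using hpq.inv_add_inv_eq_one
  have hne : ∀ᵐ y : V, y ≠ 0 := Measure.ae_ne volume 0
  set w : V → ENNReal := fun y => ENNReal.ofReal (‖y‖ ^ (-d / (p * q))) with hw
  have hwq : ∀ y, w y ^ q = ENNReal.ofReal (‖y‖ ^ (-d / p)) := fun y => by
    simp only [hw]
    rw [ENNReal.ofReal_rpow_of_nonneg (by positivity) hq.le, ← Real.rpow_mul (norm_nonneg _)]
    congr 2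
    field_simp
  have hwp : ∀ y, w y ^ p = ENNReal.ofReal (‖y‖ ^ (-d / q)) := fun y => by
    simp only [hw]
    rw [ENNReal.ofReal_rpow_of_nonneg (by positivity) hp.le, ← Real.rpow_mul (norm_nonneg _)]
    congr 2
    field_simp
  refine lintegral_rpow_lintegral_mul_le_of_schur hpq ?_ (u := w) (w := w) (by fun_prop)
    (by fun_prop) ?_ (Filter.Eventually.of_forall fun y => ENNReal.ofReal_ne_top) ?_ ?_ hh
  · simp only [Function.uncurry_def, steinWeissKernel]
    fun_prop
  · filter_upwards [hne] with y hy
    have hy' : 0 < ‖y‖ := norm_pos_iff.2 hy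
    have : 0 < ‖y‖ ^ (-d / (p * q)) := by positivity
    simpa [hw] using this
  · filter_upwards [hne] with x hx
    simp_rw [hwq]
    exact (lintegral_steinWeissKernel_mul_norm_rpow hd hpq1 hs hα hβ hx).le
  · filter_upwards [hne] with y hy
    simp_rw [hwp, steinWeissKernel_comm α β]
    rw [lintegral_steinWeissKernel_mul_norm_rpow hd (by rwa [add_comm]) (by rwa [add_comm]) hβ hα hy,
      add_comm β α, mul_comm (Real.Gamma (d / (2 * q) - β / 2)),
      mul_comm (Real.Gamma (d / (2 * p) + β / 2))]

end SteinWeiss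

/-! ### Fractional Laplacians of Schwartz functions -/

section Schwartz

variable {V : Type*} [NormedAddCommGroup V] [InnerProductSpace ℝ V] [FiniteDimensional ℝ V]

open Laplacian in
theorem SchwartzMap.coe_iterate_laplacian (u : 𝓢(V, ℂ)) (m : ℕ) :
    ⇑((Δ : 𝓢(V, ℂ) → 𝓢(V, ℂ))^[m] u) = Laplacian.laplacian^[m] (u : V → ℂ) := by
  induction m with
  | zero => rfl
  | succ m ih =>
    rw [Function.iterate_succ_apply', Function.iterate_succ_apply', ← ih]
    exact funext fun x => SchwartzMap.laplacian_apply _ x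

variable [MeasurableSpace V] [BorelSpace V]

theorem SchwartzMap.integrable_rpow_norm_mul (G : 𝓢(V, ℂ)) {s : ℝ} (hs : 0 ≤ s) :
    Integrable fun ξ : V => (((2 * Real.pi * ‖ξ‖) ^ s : ℝ) : ℂ) * G ξ := by
  have hpi := Real.pi_pos
  obtain ⟨N, hN⟩ := exists_nat_ge s
  have h0 := G.integrable_pow_mul volume 0
  have h1 := (G.integrable_pow_mul volume N).const_mul ((2 * Real.pi) ^ N)
  refine (h0.add h1).mono' (Continuous.aestronglyMeasurable ?_)
    (Filter.Eventually.of_forall fun ξ => ?_)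
  · refine Continuous.mul (Complex.continuous_ofReal.comp ?_) G.continuous
    exact Continuous.rpow_const (by fun_prop) fun _ => Or.inr hs
  · set r := 2 * Real.pi * ‖ξ‖ with hr
    have hr0 : 0 ≤ r := by positivity
    have hb : r ^ s ≤ 1 + r ^ N := by
      rcases le_total r 1 with h | h
      · exact (Real.rpow_le_one hr0 h hs).trans (le_add_of_nonneg_right (by positivity))
      · calc r ^ s ≤ r ^ (N : ℝ) := Real.rpow_le_rpow_of_exponent_le h hN
          _ = r ^ N := Real.rpow_natCast r N
          _ ≤ 1 + r ^ N := le_add_of_nonneg_left zero_le_one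
    rw [norm_mul, Complex.norm_real, Real.norm_of_nonneg (by positivity)]
    calc r ^ s * ‖G ξ‖ ≤ (1 + r ^ N) * ‖G ξ‖ := by gcongr
      _ = _ := by
        simp only [Pi.add_apply, hr, mul_pow]
        ring

open Laplacian in
theorem SchwartzMap.fourier_laplacian_apply (u : 𝓢(V, ℂ)) (ξ : V) :
    𝓕 (Δ u) ξ = -(2 * Real.pi * ‖ξ‖) ^ 2 * 𝓕 u ξ := by
  rw [SchwartzMap.laplacian_eq_fourierMultiplierCLM, SchwartzMap.fourierMultiplierCLM_apply,
    FourierTransform.fourier_smul, FourierTransform.fourier_fourierInv_eq, smul_apply,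
    SchwartzMap.smulLeftCLM_apply_apply (by fun_prop)]
  simp only [Complex.real_smul]
  push_cast
  ring

open Laplacian in
theorem SchwartzMap.fourier_iterate_laplacian_apply (u : 𝓢(V, ℂ)) (m : ℕ) (ξ : V) :
    𝓕 ((Δ : 𝓢(V, ℂ) → 𝓢(V, ℂ))^[m] u) ξ = (-(2 * Real.pi * ‖ξ‖) ^ 2) ^ m * 𝓕 u ξ := by
  induction m with
  | zero => simp
  | succ m ih =>
    rw [Function.iterate_succ_apply', SchwartzMap.fourier_laplacian_apply, ih]
    ring

end Schwartz

/-- For Schwartz functions and a natural number `m`, the Fourier-analytic `(-Δ)^m` is the iterated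
classical Laplacian, up to the sign `(-1)^m`. -/
theorem enorm_fracNegLaplacian_natCast {n : ℕ} (m : ℕ) (u : 𝓢(EuclideanSpace ℝ (Fin n), ℂ))
    (x : EuclideanSpace ℝ (Fin n)) :
    ‖fracNegLaplacian m u x‖ₑ =
      ‖(Laplacian.laplacian^[m] (u : EuclideanSpace ℝ (Fin n) → ℂ)) x‖ₑ := by
  set U : 𝓢(EuclideanSpace ℝ (Fin n), ℂ) := Laplacian.laplacian^[m] u with hU
  have e : fracNegLaplacian m u = 𝓕⁻ ⇑(((-1 : ℂ) ^ m) • 𝓕 U) := by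
    unfold fracNegLaplacian
    congr 1
    ext ξ
    rw [smul_apply, hU, SchwartzMap.fourier_iterate_laplacian_apply, smul_eq_mul,
      ← mul_assoc, ← mul_pow, SchwartzMap.fourier_coe,
      show (2 : ℝ) * (m : ℝ) = ((2 * m : ℕ) : ℝ) by push_cast; ring, Real.rpow_natCast, pow_mul]
    push_cast
    congr 1
    ring
  rw [e, ← SchwartzMap.coe_iterate_laplacian, ← hU, ← SchwartzMap.fourierInv_coe,
    FourierTransform.fourierInv_smul, FourierTransform.fourierInv_fourier_eq,
    smul_apply, enorm_smul]
  simp [enorm_pow]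

/-! ### The weighted Sobolev and Davies–Hinz inequalities -/

theorem hardyRellichConst_pos {n : ℕ} {p q α β : ℝ} (hs : 0 < α + β) (hα : α < n / p)
    (hβ : β < n / q) : 0 < hardyRellichConst n p q α β := by
  have hp2 : (n : ℝ) / (2 * p) = n / p / 2 := by rw [div_div, mul_comm p]
  have hq2 : (n : ℝ) / (2 * q) = n / q / 2 := by rw [div_div, mul_comm q]
  have h1 := Real.Gamma_pos_of_pos (show 0 < (n : ℝ) / (2 * p) - α / 2 by linarith)
  have h2 := Real.Gamma_pos_of_pos (show 0 < (n : ℝ) / (2 * q) - β / 2 by linarith)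
  have h3 := Real.Gamma_pos_of_pos (show 0 < (n : ℝ) / (2 * q) + α / 2 by linarith)
  have h4 := Real.Gamma_pos_of_pos (show 0 < (n : ℝ) / (2 * p) + β / 2 by linarith)
  unfold hardyRellichConst
  positivity

/-- The Davies–Hinz inequality is the weighted Sobolev inequality with `β = -γ/p` and
`α + β = 2m`, raised to the power `p`. -/
theorem daviesHinzConst_eq {n : ℕ} {p q γ : ℝ} {m : ℕ} (hp : 0 < p)
    (hC : 0 < hardyRellichConst n p q (2 * m + γ / p) (-γ / p)) :
    daviesHinzConst n p q γ m = (hardyRellichConst n p q (2 * m + γ / p) (-γ / p))⁻¹ ^ p := by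
  have e1 : (2 : ℝ) ^ (2 * m * p) = (2 ^ (2 * m : ℝ)) ^ p := Real.rpow_mul two_pos.le _ _
  have e2 : (hardyRellichConst n p q (2 * m + γ / p) (-γ / p))⁻¹ = 2 ^ (2 * m : ℝ) *
      ((Real.Gamma (n / (2 * q) + γ / (2 * p) + m) * Real.Gamma ((n - γ) / (2 * p))) /
      (Real.Gamma ((n - γ) / (2 * p) - m) * Real.Gamma (n / (2 * q) + γ / (2 * p)))) := by
    rw [hardyRellichConst, mul_inv, inv_div, ← Real.rpow_neg two_pos.le, neg_neg]
    congr 2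
    · ring
    · congr 2 <;> field_simp <;> ring
    · congr 2 <;> field_simp <;> ring
  have h2 : (0 : ℝ) < 2 ^ (2 * m : ℝ) := by positivity
  have hX := inv_pos.2 hC
  rw [e2] at hX ⊢
  rw [daviesHinzConst, e1, Real.mul_rpow h2.le (pos_of_mul_pos_right hX h2.le).le]

/-- The weighted Sobolev inequality. A Schwartz function is dominated by the Riesz potential of its
fractional Laplacian, to which the Stein–Weiss inequality applies. -/
theorem eLpNorm_norm_rpow_mul_le {n : ℕ} {p q : ℝ} (hpq : p.HolderConjugate q) {α β : ℝ}
    (hs : 0 < α + β) (hα : α < n / p) (hβ : β < n / q) (g : 𝓢(EuclideanSpace ℝ (Fin n), ℂ)) :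
    eLpNorm (fun x => ((‖x‖ ^ (-α) : ℝ) : ℂ) * g x) (ENNReal.ofReal p) volume ≤
      ENNReal.ofReal (hardyRellichConst n p q α β) *
        eLpNorm (fun x => ((‖x‖ ^ β : ℝ) : ℂ) * fracNegLaplacian ((α + β) / 2) g x)
          (ENNReal.ofReal p) volume := by
  have hp : 0 < p := hpq.pos
  have hn : n ≠ 0 := by
    rintro rfl
    simp only [Nat.cast_zero, zero_div] at hα hβ
    linarith
  have : Nonempty (Fin n) := Fin.pos_iff_nonempty.1 (Nat.pos_of_ne_zero hn)
  have hne : ∀ᵐ x : EuclideanSpace ℝ (Fin n), x ≠ 0 := Measure.ae_ne volume 0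
  have hΓ := Real.Gamma_pos_of_pos (half_pos hs)
  have hC := hardyRellichConst_pos hs hα hβ
  have hd : (n : ℝ) = Module.finrank ℝ (EuclideanSpace ℝ (Fin n)) := by simp
  set f := fracNegLaplacian ((α + β) / 2) g with hf
  have hfF : f = 𝓕⁻ (fun ξ : EuclideanSpace ℝ (Fin n) =>
      (((2 * Real.pi * ‖ξ‖) ^ (α + β) : ℝ) : ℂ) * (𝓕 g) ξ) := by
    rw [hf, fracNegLaplacian, mul_div_cancel₀ _ two_ne_zero]
    rfl
  have hFint := (𝓕 g).integrable_rpow_norm_mul hs.le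
  have hfm : Measurable f := by
    rw [hfF]
    exact (continuous_fourierInv_of_integrable hFint).measurable
  have hpt : ∀ x, ENNReal.ofReal (Real.Gamma ((α + β) / 2)) * ‖g x‖ₑ ≤
      ∫⁻ y, rieszKernel (α + β) (x - y) * ‖f y‖ₑ := fun x => by
    have h := ofReal_Gamma_mul_enorm_fourierInv_le hs (𝓕 g).integrable hFint x
    rwa [← hfF, ← SchwartzMap.fourierInv_coe, FourierTransform.fourierInv_fourier_eq] at h
  set h : EuclideanSpace ℝ (Fin n) → ENNReal := fun y => ‖((‖y‖ ^ β : ℝ) : ℂ) * f y‖ₑ with hh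
  have hhm : Measurable h := by
    simp only [hh]
    fun_prop
  have hle : ∀ x, ENNReal.ofReal (Real.Gamma ((α + β) / 2)) * ‖((‖x‖ ^ (-α) : ℝ) : ℂ) * g x‖ₑ ≤
      ∫⁻ y, steinWeissKernel α β x y * h y := fun x => by
    calc ENNReal.ofReal (Real.Gamma ((α + β) / 2)) * ‖((‖x‖ ^ (-α) : ℝ) : ℂ) * g x‖ₑ
        = ENNReal.ofReal (‖x‖ ^ (-α)) *
            (ENNReal.ofReal (Real.Gamma ((α + β) / 2)) * ‖g x‖ₑ) := by
          rw [enorm_mul, enorm_complex_ofReal, Real.enorm_of_nonneg (by positivity),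
            mul_left_comm]
      _ ≤ ENNReal.ofReal (‖x‖ ^ (-α)) * ∫⁻ y, rieszKernel (α + β) (x - y) * ‖f y‖ₑ := by
          gcongr
          exact hpt x
      _ = ∫⁻ y, steinWeissKernel α β x y * h y := by
          rw [← lintegral_const_mul _ (by fun_prop)]
          refine lintegral_congr_ae ?_
          filter_upwards [hne] with y hy
          have hy' : 0 < ‖y‖ := norm_pos_iff.2 hy
          have e : ENNReal.ofReal (‖y‖ ^ (-β)) * ENNReal.ofReal (‖y‖ ^ β) = 1 := by
            rw [← ENNReal.ofReal_mul (by positivity), ← Real.rpow_add hy']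
            simp
          simp only [hh, steinWeissKernel]
          rw [enorm_mul, enorm_complex_ofReal, Real.enorm_of_nonneg (by positivity),
            mul_assoc _ _ (_ * _), ← mul_assoc (ENNReal.ofReal (‖y‖ ^ (-β))), e, one_mul, mul_assoc]
  have key := (lintegral_mono fun x => ENNReal.rpow_le_rpow (hle x) hp.le).trans
    (lintegral_rpow_lintegral_steinWeissKernel_le hd hpq hs hα hβ hhm)
  simp_rw [ENNReal.mul_rpow_of_nonneg _ _ hp.le] at key
  rw [lintegral_const_mul' _ _ (ENNReal.rpow_ne_top_of_nonneg hp.le ENNReal.ofReal_ne_top),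
    ENNReal.ofReal_mul hΓ.le, ENNReal.mul_rpow_of_nonneg _ _ hp.le, mul_assoc,
    ENNReal.mul_le_mul_iff_right
      (by simpa [ENNReal.rpow_eq_zero_iff, hp, hp.not_gt] using hΓ)
      (ENNReal.rpow_ne_top_of_nonneg hp.le ENNReal.ofReal_ne_top)] at key
  have hp0 : ENNReal.ofReal p ≠ 0 := by simpa using hp
  rw [eLpNorm_eq_lintegral_rpow_enorm_toReal hp0 ENNReal.ofReal_ne_top,
    eLpNorm_eq_lintegral_rpow_enorm_toReal hp0 ENNReal.ofReal_ne_top, ENNReal.toReal_ofReal hp.le]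
  calc _ ≤ _ := ENNReal.rpow_le_rpow key (by positivity : 0 ≤ 1 / p)
    _ = _ := by
      rw [ENNReal.mul_rpow_of_nonneg _ _ (by positivity), ← ENNReal.rpow_mul,
        mul_one_div_cancel hp.ne', ENNReal.rpow_one]
      rfl

theorem lintegral_norm_rpow_mul_eq_eLpNorm_rpow {n : ℕ} {p : ℝ} (hp : 0 < p) (a : ℝ)
    (v : EuclideanSpace ℝ (Fin n) → ℂ) :
    ∫⁻ x, ENNReal.ofReal (‖x‖ ^ (a * p) * ‖v x‖ ^ p) =
      eLpNorm (fun x => ((‖x‖ ^ a : ℝ) : ℂ) * v x) (ENNReal.ofReal p) volume ^ p := by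
  have hp0 : ENNReal.ofReal p ≠ 0 := by simpa using hp
  rw [eLpNorm_eq_lintegral_rpow_enorm_toReal hp0 ENNReal.ofReal_ne_top, ENNReal.toReal_ofReal hp.le,
    ← ENNReal.rpow_mul, one_div_mul_cancel hp.ne', ENNReal.rpow_one]
  refine lintegral_congr fun x => ?_
  rw [Real.rpow_mul (norm_nonneg _), ← Real.mul_rpow (by positivity) (norm_nonneg _),
    ← ENNReal.ofReal_rpow_of_nonneg (by positivity) hp.le, ENNReal.ofReal_mul (by positivity),
    enorm_mul, enorm_complex_ofReal, Real.enorm_of_nonneg (by positivity), ofReal_norm]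

theorem theorem3 (n : ℕ) (p q : ℝ) (hp : 1 < p) (hpq : 1 / p + 1 / q = 1) :
    (∀ α β : ℝ, 0 < α + β → α + β < n → α < n / p → β < n / q →
      ∀ g : 𝓢(EuclideanSpace ℝ (Fin n), ℂ),
        eLpNorm (fun x => ((‖x‖ ^ (-α) : ℝ) : ℂ) * g x) (ENNReal.ofReal p) volume ≤
          ENNReal.ofReal (hardyRellichConst n p q α β) *
            eLpNorm (fun x => ((‖x‖ ^ β : ℝ) : ℂ) * fracNegLaplacian ((α + β) / 2) g x)
              (ENNReal.ofReal p) volume) ∧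
    (∀ (m : ℕ) (γ : ℝ), 1 ≤ m → γ + 2 * m * p < n → -γ / p < n / q →
      0 < daviesHinzConst n p q γ m ∧
      ∀ u : 𝓢(EuclideanSpace ℝ (Fin n), ℂ),
        ENNReal.ofReal (daviesHinzConst n p q γ m) *
            ∫⁻ x, ENNReal.ofReal (‖x‖ ^ (-γ - 2 * m * p) * ‖u x‖ ^ p) ≤
          ∫⁻ x, ENNReal.ofReal (‖x‖ ^ (-γ) *
            ‖(Laplacian.laplacian^[m] (u : EuclideanSpace ℝ (Fin n) → ℂ)) x‖ ^ p)) := by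
  have hp0 : 0 < p := one_pos.trans hp
  have hconj : p.HolderConjugate q :=
    Real.holderConjugate_iff.2 ⟨hp, by simpa using hpq⟩
  refine ⟨fun α β hs _ hα hβ g => eLpNorm_norm_rpow_mul_le hconj hs hα hβ g,
    fun m γ hm hγ hβ => ?_⟩
  have hm' : (1 : ℝ) ≤ m := by exact_mod_cast hm
  set α := 2 * (m : ℝ) + γ / p with hα_def
  set β := -γ / p with hβ_def
  have hαβ : α + β = 2 * m := by
    rw [hα_def, hβ_def]
    ring
  have hs : 0 < α + β := by linarith
  have hα : α < n / p := by
    rw [lt_div_iff₀ hp0, hα_def, add_mul, div_mul_cancel₀ _ hp0.ne']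
    linarith
  have hC := hardyRellichConst_pos hs hα hβ
  have hD := daviesHinzConst_eq (m := m) hp0 hC
  rw [← hα_def, ← hβ_def] at hD
  refine ⟨hD ▸ Real.rpow_pos_of_pos (inv_pos.2 hC) _, fun u => ?_⟩
  have hE := eLpNorm_norm_rpow_mul_le hconj hs hα hβ u
  rw [hαβ, mul_div_cancel_left₀ _ two_ne_zero] at hE
  have hlap : eLpNorm (fun x => ((‖x‖ ^ β : ℝ) : ℂ) * fracNegLaplacian m u x)
      (ENNReal.ofReal p) volume = eLpNorm (fun x => ((‖x‖ ^ β : ℝ) : ℂ) *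
        (Laplacian.laplacian^[m] (u : EuclideanSpace ℝ (Fin n) → ℂ)) x)
        (ENNReal.ofReal p) volume := by
    refine eLpNorm_congr_enorm_ae (Filter.Eventually.of_forall fun x => ?_)
    rw [enorm_mul, enorm_mul, enorm_fracNegLaplacian_natCast]
  rw [hlap] at hE
  have e1 : -γ - 2 * m * p = -α * p := by
    rw [hα_def, neg_mul, add_mul, div_mul_cancel₀ _ hp0.ne']
    ring
  have e2 : -γ = β * p := (div_mul_cancel₀ _ hp0.ne').symm
  rw [e1, lintegral_norm_rpow_mul_eq_eLpNorm_rpow hp0]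
  conv_rhs => rw [e2, lintegral_norm_rpow_mul_eq_eLpNorm_rpow hp0]
  have hcancel : ENNReal.ofReal (daviesHinzConst n p q γ m) *
      ENNReal.ofReal (hardyRellichConst n p q α β) ^ p = 1 := by
    rw [hD, ENNReal.ofReal_rpow_of_nonneg hC.le hp0.le, ← ENNReal.ofReal_mul (by positivity),
      ← Real.mul_rpow (by positivity) hC.le, inv_mul_cancel₀ hC.ne', Real.one_rpow,
      ENNReal.ofReal_one]
  calc _ ≤ _ := mul_le_mul_right (ENNReal.rpow_le_rpow hE hp0.le) _
    _ = _ := by rw [ENNReal.mul_rpow_of_nonneg _ _ hp0.le, ← mul_assoc, hcancel, one_mul]
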